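/- Let $L$ be a multiplicative lattice: a complete lattice with least element $0$ and greatest element $1$ and a commutative associative multiplication such that $1x=x$ and $x\bigvee E=\bigvee\{xe\mid e\in E\}$ for all $x\in L$ and $E\subseteq L$. Write $(a:b)=\bigvee\{x\in L\mid xb\le a\}$. An element $e$ is *principal* if $a\wedge be=((a:e)\wedge b)e$ and $((a\vee be):e)=(a:e)\vee b$ for all $a,b\in L$. Assume that $L$ is a *C-lattice* (every element is a join of elements of some multiplicatively closed set $C\ni 1$ of compact elements) and *principally generated* (every element is a join of principal elements). An element $p<1$ is *prime* if $ab\le p$ implies $a\le p$ or $b\le p$, for all $a,b\in L$. An element $x<1$ is an *OA-element* ($1$-absorbing prime element) if for all $a,b,c\in L\setminus\{1\}$, $abc\le x$ implies $ab\le x$ or $c\le x$. An *OA-factorization* of an element is an expression of it as a finite (possibly empty) product of OA-elements; the empty product is $1$. $L$ is an *OAFL* if every element of $L$ has an OA-factorization, a *COAFL* if every compact element of $L$ has an OA-factorization, and a *ZPI-lattice* if every element of $L$ is a finite (possibly empty) product of prime elements. $L$ is *quasi-local* if $1$ is compact and $L$ has a unique maximal element (a maximal element being one that is maximal among the elements $<1$),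 and $L$ is a *lattice domain* if $0$ is prime. An element $a$ is *comparable* if $a\le b$ or $b\le a$ for each $b\in L$, and *nilpotent* if $a^n=0$ for some $n\in\mathbb{N}$. Let $m={\rm J}(L)$ be the meet of all maximal elements of $L$. The following statements are equivalent. 1. $L$ is an OAFL. 2. $L$ is a COAFL. 3. The join of any two principal elements of $L$ has an OA-factorization. 4. $L$ satisfies one of the following conditions: (a) $L$ is a ZPI-lattice; (b) $L$ is quasi-local, $m^2$ is comparable and $m$ is nilpotent; (c) $L$ is a quasi-local lattice domain, $m^2$ is comparable and $\bigwedge_{n\in\mathbb{N}}m^n=0$. -/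

import Mathlib

namespace MultLattice

/-- A multiplicative lattice: a commutative monoid on a complete lattice whose multiplication
distributes over arbitrary joins (including the empty one) and whose identity is the top. -/
class IsMultiplicativeLattice (L : Type*) [CommMonoid L] [CompleteLattice L] : Prop
    extends IsQuantale L where
  one_eq_top : (1 : L) = ⊤

section

variable {L : Type*} [CommMonoid L] [CompleteLattice L] [IsMultiplicativeLattice L]

/-- The residual `(a : b) = ⋁ {x | x * b ≤ a}`. -/
def residual (a b : L) : L := Quantale.leftMulResiduation b a

/-- `a ∧ b e = ((a : e) ∧ b) e` for all `a`, `b`. -/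
def IsMeetPrincipal (e : L) : Prop :=
  ∀ a b : L, a ⊓ b * e = (residual a e ⊓ b) * e

/-- `((a ∨ b e) : e) = (a : e) ∨ b` for all `a`, `b`. -/
def IsJoinPrincipal (e : L) : Prop :=
  ∀ a b : L, residual (a ⊔ b * e) e = residual a e ⊔ b

def IsPrincipal (e : L) : Prop := IsMeetPrincipal e ∧ IsJoinPrincipal e

variable (L) in
/-- Every element is a join of principal elements. -/
def IsPrincipallyGenerated : Prop :=
  ∀ a : L, ∃ S : Set L, (∀ e ∈ S, IsPrincipal e) ∧ a = sSup S

variable (L) in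
/-- `L` is generated under joins by a multiplicatively closed set (containing `1`) of compact
elements. -/
def IsCLattice : Prop :=
  ∃ C : Submonoid L, (∀ c ∈ C, IsCompactElement c) ∧
    ∀ a : L, ∃ S : Set L, S ⊆ (C : Set L) ∧ a = sSup S

/-- A proper element `p` such that `a b ≤ p` implies `a ≤ p` or `b ≤ p`. -/
def IsPrimeElement (p : L) : Prop :=
  p < 1 ∧ ∀ a b : L, a * b ≤ p → a ≤ p ∨ b ≤ p

/-- A 1-absorbing prime element (OA-element). -/
def IsOAElement (x : L) : Prop :=
  x < 1 ∧ ∀ a b c : L, a ≠ 1 → b ≠ 1 → c ≠ 1 → a * b * c ≤ x → a * b ≤ x ∨ c ≤ x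

/-- `x` is a finite (possibly empty) product of OA-elements. -/
def HasOAFactorization (x : L) : Prop :=
  ∃ s : Multiset L, (∀ y ∈ s, IsOAElement y) ∧ x = s.prod

/-- `x` is a finite (possibly empty) product of prime elements. -/
def HasPrimeFactorization (x : L) : Prop :=
  ∃ s : Multiset L, (∀ y ∈ s, IsPrimeElement y) ∧ x = s.prod

variable (L) in
/-- Every element has an OA-factorization. -/
def IsOAFL : Prop := ∀ x : L, HasOAFactorization x

variable (L) in
/-- Every compact element has an OA-factorization. -/
def IsCOAFL : Prop := ∀ x : L, IsCompactElement x → HasOAFactorization x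

variable (L) in
/-- Every element is a finite product of prime elements. -/
def IsZPILattice : Prop := ∀ x : L, HasPrimeFactorization x

variable (L) in
/-- The meet `J(L)` of all maximal elements (coatoms). -/
def jacobson : L := sInf {m : L | IsCoatom m}

variable (L) in
/-- `1` is compact and there is a unique maximal element. -/
def IsQuasiLocal : Prop := IsCompactElement (1 : L) ∧ ∃! m : L, IsCoatom m

variable (L) in
/-- `0` is a prime element. -/
def IsLatticeDomain : Prop := IsPrimeElement (⊥ : L)

def IsComparable (a : L) : Prop := ∀ b : L, a ≤ b ∨ b ≤ a

/-- Some power of `a` is the least element `0` of the lattice. -/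
def IsNilpotentElement (a : L) : Prop := ∃ n : ℕ, a ^ n = ⊥

end

end MultLattice

set_option linter.unusedSectionVars false

namespace MultLattice


/-! ### Residuals, principal, compact and prime elements -/

section Basics

variable {L : Type*} [CommMonoid L] [CompleteLattice L] [IsMultiplicativeLattice L]

/-! The theorem splits on whether every OA-element is prime. A non-prime OA-element forces a unique
maximal element `m` with `m ^ 2` below it (`IsOAElement.isPrimeElement_or`), so otherwise
factorizations of joins of two principal elements are prime factorizations.

In the prime case the lattice is ZPI (`isZPILattice_of_supHasPrimeFactorization`). The argument
imitates localization at a prime through `LocLE`, with Nakayama's lemma for principal elements as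
the main tool. A locally principal prime behaves like the maximal ideal of a local principal ideal
ring: smaller primes vanish locally, and locally nonzero principal elements are powers of it. A
prime that is not locally principal vanishes locally (`locLE_bot_of_not_isLocPrincipal`). Hence
every `x` is locally a power of each maximal element above it, up to factors that vanish, and the
finitely many relevant local exponents, together with some prime factors of `0`, assemble to a
global factorization.

In the quasi-local case a principal `e ≤ m` outside `m ^ 2` satisfies `m ^ 2 ≤ e`
(`sq_le_of_isPrincipal`), so `m ^ 2` is comparable and `m ^ (k + 1) = m * e ^ k`. The powers of `e`
then act like a discrete valuation: either `m` is nilpotent, or the meet of its powers is prime and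
equal to `0`. Conversely, proper elements not below `m ^ 2` are OA-elements, and any other element
is reached by dividing out powers of `e` (`isOAFL_of_isComparable_sq`). -/

theorem le_one' (x : L) : x ≤ 1 := by
  rw [IsMultiplicativeLattice.one_eq_top]; exact le_top

theorem mul_le_left (x y : L) : x * y ≤ x := mul_le_of_le_one_right' (le_one' y)

theorem mul_le_right (x y : L) : x * y ≤ y := mul_le_of_le_one_left' (le_one' x)

theorem lt_one_iff {x : L} : x < 1 ↔ x ≠ 1 := (le_one' x).lt_iff_ne

theorem eq_one_of_le {x : L} (h : 1 ≤ x) : x = 1 := le_antisymm (le_one' x) h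

theorem le_residual {a b x : L} : x ≤ residual a b ↔ x * b ≤ a :=
  Quantale.leftMulResiduation_le_iff_mul_le

theorem residual_mul_le (a b : L) : residual a b * b ≤ a := le_residual.1 le_rfl

theorem residual_eq_one {a b : L} (h : b ≤ a) : residual a b = 1 :=
  eq_one_of_le (le_residual.2 (by rwa [one_mul]))

theorem residual_mul (a b c : L) : residual a (b * c) = residual (residual a c) b :=
  eq_of_forall_le_iff fun x => by rw [le_residual, le_residual, le_residual, mul_assoc]

theorem residual_one (a : L) : residual a 1 = a :=
  eq_of_forall_le_iff fun x => by rw [le_residual, mul_one]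

theorem isPrincipal_bot : IsPrincipal (⊥ : L) := by
  constructor
  · intro a b; simp
  · intro a b
    rw [residual_eq_one bot_le, residual_eq_one bot_le]
    exact (sup_eq_left.2 (le_one' b)).symm

theorem isPrincipal_one : IsPrincipal (1 : L) := by
  constructor
  · intro a b; simp [residual_one]
  · intro a b; simp [residual_one]

theorem IsPrincipal.mul {e f : L} (he : IsPrincipal e) (hf : IsPrincipal f) :
    IsPrincipal (e * f) := by
  constructor
  · intro a b
    rw [← mul_assoc, hf.1, he.1, residual_mul, mul_assoc]
  · intro a b
    rw [residual_mul, ← mul_assoc, hf.2, he.2, residual_mul]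

theorem IsPrincipal.pow {e : L} (he : IsPrincipal e) (n : ℕ) : IsPrincipal (e ^ n) := by
  induction n with
  | zero => simpa using isPrincipal_one
  | succ n ih => rw [pow_succ]; exact ih.mul he

/-- An element below a principal element is a multiple of it. -/
theorem IsPrincipal.residual_mul_eq {e x : L} (he : IsPrincipal e) (h : x ≤ e) :
    residual x e * e = x := by
  have := he.1 x 1
  rw [one_mul, inf_eq_left.2 h, inf_eq_left.2 (le_one' _)] at this
  exact this.symm

theorem isPrincipal_le_of_forall (hP : IsPrincipallyGenerated L) {x y : L}
    (h : ∀ e, IsPrincipal e → e ≤ x → e ≤ y) : x ≤ y := by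
  obtain ⟨S, hS, rfl⟩ := hP x
  exact sSup_le fun e he => h e (hS e he) (le_sSup he)

theorem exists_isPrincipal_of_not_le (hP : IsPrincipallyGenerated L) {x y : L}
    (h : ¬ x ≤ y) : ∃ e, IsPrincipal e ∧ e ≤ x ∧ ¬ e ≤ y := by
  by_contra! h'
  exact h (isPrincipal_le_of_forall hP h')

theorem IsCLattice.isCompactElement_one (hC : IsCLattice L) : IsCompactElement (1 : L) := by
  obtain ⟨C, hC, -⟩ := hC
  exact hC 1 C.one_mem

theorem IsCLattice.isCompactlyGenerated (hC : IsCLattice L) : IsCompactlyGenerated L := by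
  obtain ⟨C, hC, h⟩ := hC
  exact ⟨fun x => by
    obtain ⟨S, hS, hx⟩ := h x
    exact ⟨S, fun y hy => hC y (hS hy), hx.symm⟩⟩

theorem residual_mono_left {a b : L} (h : a ≤ b) (e : L) : residual a e ≤ residual b e :=
  le_residual.2 ((residual_mul_le a e).trans h)

theorem biSup_mul {S : Set L} (f : L → L) (e : L) :
    (⨆ s ∈ S, f s) * e = ⨆ s ∈ S, f s * e := by
  rw [← sSup_image, sSup_mul_distrib, iSup_image]

/-- A principal element of a C-lattice is compact. -/
theorem IsPrincipal.isCompactElement (hC : IsCLattice L) {e : L} (he : IsPrincipal e) :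
    IsCompactElement e := by
  have := hC.isCompactlyGenerated
  rw [CompleteLattice.isCompactElement_iff_le_of_directed_sSup_le]
  intro S hne hdir hle
  have h1 : (⨆ s ∈ S, residual s e) * e = e := by
    rw [biSup_mul]
    calc ⨆ s ∈ S, residual s e * e = ⨆ s ∈ S, e ⊓ s := by
          refine iSup_congr fun s => iSup_congr fun hs => ?_
          have := he.1 s 1
          rw [one_mul, inf_eq_left.2 (le_one' (residual s e))] at this
          rw [← this, inf_comm]
      _ = e := by rw [← hdir.inf_sSup_eq, inf_eq_left.2 hle]
  -- Join-principality cancels `e` from `h1` up to its annihilator, which lies below every `residual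
  -- s e`; compactness of `1` then selects a single `s`.
  have h2 := he.2 ⊥ (⨆ s ∈ S, residual s e)
  rw [h1, residual_eq_one le_sup_right] at h2
  have h3 : (1 : L) ≤ sSup ((fun s => residual s e) '' S) := by
    rw [h2, sSup_image]
    refine sup_le ?_ le_rfl
    obtain ⟨s, hs⟩ := hne
    exact (residual_mono_left bot_le e).trans (le_iSup₂_of_le s hs le_rfl)
  have h4 : DirectedOn (· ≤ ·) ((fun s => residual s e) '' S) :=
    hdir.mono_comp (fun _ _ h => residual_mono_left h e)
  obtain ⟨_, ⟨s, hs, rfl⟩, h5⟩ :=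
    (CompleteLattice.isCompactElement_iff_le_of_directed_sSup_le L 1).1
      hC.isCompactElement_one _ (hne.image _) h4 h3
  exact ⟨s, hs, by simpa using le_residual.1 h5⟩

theorem isCompactElement_sup {a b : L} (ha : IsCompactElement a) (hb : IsCompactElement b) :
    IsCompactElement (a ⊔ b) := by
  classical
  have := CompleteLattice.isCompactElement_finsetSup (f := id) (s := {a, b})
    (by simp [ha, hb])
  simpa using this

theorem exists_isCoatom_ge (h1 : IsCompactElement (1 : L)) {x : L} (hx : x ≠ 1) :
    ∃ m, IsCoatom m ∧ x ≤ m := by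
  rw [IsMultiplicativeLattice.one_eq_top] at h1 hx
  have := CompleteLattice.coatomic_of_top_compact h1
  exact (eq_top_or_exists_le_coatom x).resolve_left hx

theorem isCoatom_lt_one {m : L} (h : IsCoatom m) : m < 1 := by
  rw [IsMultiplicativeLattice.one_eq_top]; exact h.lt_top

theorem isCoatom_sup_eq_one {m x : L} (h : IsCoatom m) (hx : ¬ x ≤ m) : m ⊔ x = 1 := by
  rw [IsMultiplicativeLattice.one_eq_top]
  exact h.2 _ (left_lt_sup.2 hx)

theorem isPrimeElement_of_isCoatom {m : L} (h : IsCoatom m) : IsPrimeElement m := by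
  refine ⟨isCoatom_lt_one h, fun a b hab => ?_⟩
  by_contra! hc
  have h1 : (m ⊔ a) * (m ⊔ b) ≤ m := by
    rw [Quantale.mul_sup_distrib, Quantale.sup_mul_distrib, Quantale.sup_mul_distrib]
    exact sup_le (sup_le (mul_le_left _ _) (mul_le_right _ _)) (sup_le (mul_le_left _ _) hab)
  rw [isCoatom_sup_eq_one h hc.1, isCoatom_sup_eq_one h hc.2, mul_one] at h1
  exact (isCoatom_lt_one h).not_ge h1

theorem IsPrimeElement.not_one_le {p : L} (hp : IsPrimeElement p) : ¬ 1 ≤ p := hp.1.not_ge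

theorem IsPrimeElement.mul_not_le {p : L} (hp : IsPrimeElement p) {a b : L} (ha : ¬ a ≤ p)
    (hb : ¬ b ≤ p) : ¬ a * b ≤ p := fun h => (hp.2 a b h).elim ha hb

theorem IsPrimeElement.le_of_pow_le {p : L} (hp : IsPrimeElement p) {a : L} {n : ℕ}
    (h : a ^ n ≤ p) : a ≤ p := by
  induction n with
  | zero => rw [pow_zero] at h; exact absurd h hp.not_one_le
  | succ n ih => rw [pow_succ] at h; exact (hp.2 _ _ h).elim ih id

theorem IsPrimeElement.multiset_prod_le {p : L} (hp : IsPrimeElement p) {s : Multiset L}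
    (h : s.prod ≤ p) : ∃ q ∈ s, q ≤ p := by
  induction s using Multiset.induction_on with
  | empty => rw [Multiset.prod_zero] at h; exact absurd h hp.not_one_le
  | cons a s ih =>
    rw [Multiset.prod_cons] at h
    rcases hp.2 _ _ h with h | h
    · exact ⟨a, Multiset.mem_cons_self a s, h⟩
    · obtain ⟨q, hq, hqp⟩ := ih h
      exact ⟨q, Multiset.mem_cons_of_mem hq, hqp⟩

theorem multiset_prod_le_of_mem {s : Multiset L} {q : L} (h : q ∈ s) : s.prod ≤ q := by
  obtain ⟨t, rfl⟩ := Multiset.exists_cons_of_mem h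
  rw [Multiset.prod_cons]; exact mul_le_left _ _

theorem HasPrimeFactorization.mul {x y : L} (hx : HasPrimeFactorization x)
    (hy : HasPrimeFactorization y) : HasPrimeFactorization (x * y) := by
  obtain ⟨s, hs, rfl⟩ := hx
  obtain ⟨t, ht, rfl⟩ := hy
  exact ⟨s + t, fun y hy => (Multiset.mem_add.1 hy).elim (hs y) (ht y),
    (Multiset.prod_add s t).symm⟩

theorem hasPrimeFactorization_one : HasPrimeFactorization (1 : L) := ⟨0, by simp, by simp⟩

theorem IsPrimeElement.hasPrimeFactorization {p : L} (hp : IsPrimeElement p) :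
    HasPrimeFactorization p := ⟨{p}, by simpa using hp, by simp⟩

theorem HasPrimeFactorization.pow {x : L} (hx : HasPrimeFactorization x) (n : ℕ) :
    HasPrimeFactorization (x ^ n) := by
  induction n with
  | zero => simpa using hasPrimeFactorization_one
  | succ n ih => rw [pow_succ]; exact ih.mul hx

theorem hasPrimeFactorization_finset_prod {ι : Type*} (s : Finset ι) (f : ι → L)
    (h : ∀ i ∈ s, HasPrimeFactorization (f i)) : HasPrimeFactorization (∏ i ∈ s, f i) :=
  Finset.prod_induction f HasPrimeFactorization (fun _ _ => HasPrimeFactorization.mul)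
    hasPrimeFactorization_one h

theorem multiset_prod_le_pow {s : Multiset L} {y : L} (h : ∀ x ∈ s, x ≤ y) :
    s.prod ≤ y ^ s.card := by
  induction s using Multiset.induction_on with
  | empty => simp
  | cons a s ih =>
    rw [Multiset.prod_cons, Multiset.card_cons, pow_succ']
    exact mul_le_mul' (h a (Multiset.mem_cons_self a s))
      (ih fun x hx => h x (Multiset.mem_cons_of_mem hx))

theorem pow_le_multiset_prod {s : Multiset L} {y : L} (h : ∀ x ∈ s, y ≤ x) :
    y ^ s.card ≤ s.prod := by
  induction s using Multiset.induction_on with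
  | empty => simp
  | cons a s ih =>
    rw [Multiset.prod_cons, Multiset.card_cons, pow_succ']
    exact mul_le_mul' (h a (Multiset.mem_cons_self a s))
      (ih fun x hx => h x (Multiset.mem_cons_of_mem hx))

theorem finset_prod_le_of_mem {ι : Type*} {s : Finset ι} (f : ι → L) {i : ι} (hi : i ∈ s) :
    ∏ j ∈ s, f j ≤ f i :=
  multiset_prod_le_of_mem (Multiset.mem_map_of_mem f hi)

theorem IsPrimeElement.finset_prod_le {p : L} (hp : IsPrimeElement p) {ι : Type*} {s : Finset ι}
    {f : ι → L} (h : ∏ j ∈ s, f j ≤ p) : ∃ i ∈ s, f i ≤ p := by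
  obtain ⟨q, hq, hqp⟩ := hp.multiset_prod_le h
  obtain ⟨i, hi, rfl⟩ := Multiset.mem_map.1 hq
  exact ⟨i, hi, hqp⟩

/-! ### Localization at a prime and Nakayama's lemma -/

/-- `x ≤ y` after localization at `t`, for principal `x`. -/
def LocLE (t x y : L) : Prop := ∃ s, ¬ s ≤ t ∧ s * x ≤ y

section LocLE

variable {t x y z w : L}

theorem LocLE.of_le (ht : IsPrimeElement t) (h : x ≤ y) : LocLE t x y :=
  ⟨1, ht.not_one_le, by rwa [one_mul]⟩

theorem LocLE.trans (ht : IsPrimeElement t) (h : LocLE t x y) (h' : LocLE t y z) :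
    LocLE t x z := by
  obtain ⟨s, hs, h⟩ := h
  obtain ⟨s', hs', h'⟩ := h'
  refine ⟨s' * s, ht.mul_not_le hs' hs, ?_⟩
  rw [mul_assoc]
  exact (mul_le_mul_right h s').trans h'

theorem LocLE.mul_left (h : LocLE t x y) (z : L) : LocLE t (z * x) (z * y) := by
  obtain ⟨s, hs, h⟩ := h
  exact ⟨s, hs, by rw [mul_left_comm]; exact mul_le_mul_right h z⟩

theorem LocLE.mono (h : LocLE t x y) (hle : w ≤ t) : LocLE w x y := by
  obtain ⟨s, hs, h⟩ := h
  exact ⟨s, fun h' => hs (h'.trans hle), h⟩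

theorem LocLE.sup (ht : IsPrimeElement t) (h : LocLE t x z) (h' : LocLE t y z) :
    LocLE t (x ⊔ y) z := by
  obtain ⟨s, hs, h⟩ := h
  obtain ⟨s', hs', h'⟩ := h'
  refine ⟨s * s', ht.mul_not_le hs hs', ?_⟩
  rw [Quantale.mul_sup_distrib]
  refine sup_le ?_ ?_
  · rw [mul_right_comm]; exact (mul_le_left _ _).trans h
  · rw [mul_assoc]; exact (mul_le_right _ _).trans h'

theorem LocLE.le_of_isPrimeElement (h : LocLE t x y) {p : L} (hp : IsPrimeElement p)
    (hpt : p ≤ t) (hy : y ≤ p) : x ≤ p := by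
  obtain ⟨s, hs, h⟩ := h
  exact (hp.2 _ _ (h.trans hy)).resolve_left fun h' => hs (h'.trans hpt)

/-- Nakayama's lemma for a principal element. -/
theorem LocLE.of_mul_le_sup (hx : IsPrincipal x) {s : L} (hs : ¬ s ≤ t)
    (h : s * x ≤ x * t ⊔ y) : LocLE t x y := by
  -- The largest possible multiplier is `residual y x`. Join-principality gives `s ≤ residual y x ⊔
  -- t`, so it cannot lie below `t`.
  refine ⟨residual y x, fun h' => hs ?_, residual_mul_le y x⟩
  have h1 : s ≤ residual (y ⊔ t * x) x := le_residual.2 (by rwa [sup_comm, mul_comm t])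
  rw [hx.2] at h1
  exact h1.trans (sup_le h' le_rfl)

theorem LocLE.bot_of_mul_le (hx : IsPrincipal x) {s : L} (hs : ¬ s ≤ t)
    (h : s * x ≤ x * t) : LocLE t x ⊥ :=
  LocLE.of_mul_le_sup hx hs (by rwa [sup_bot_eq])

/-- A locally nonzero principal element is locally completely join-irreducible. -/
theorem exists_locLE_of_eq_sSup (ht : IsPrimeElement t) (hx : IsPrincipal x)
    (h0 : ¬ LocLE t x ⊥) {S : Set L} (hS : x = sSup S) : ∃ y ∈ S, LocLE t x y := by
  by_contra! hc
  have h1 : (⨆ y ∈ S, residual y x) * x = x := by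
    calc (⨆ y ∈ S, residual y x) * x = ⨆ y ∈ S, residual y x * x := biSup_mul _ _
      _ = ⨆ y ∈ S, y := iSup_congr fun y => iSup_congr fun hy => ?_
      _ = x := by rw [hS, sSup_eq_iSup]
    have := hx.1 y 1
    rw [one_mul, inf_eq_left.2 (le_one' (residual y x))] at this
    rw [← this, inf_eq_left]
    exact (le_sSup hy).trans hS.ge
  -- This writes `1` as the annihilator of `x` joined with all `residual y x`. These cannot all lie
  -- below `t`, and one that does not is the required multiplier.
  have h2 := hx.2 ⊥ (⨆ y ∈ S, residual y x)
  rw [h1, residual_eq_one le_sup_right] at h2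
  refine ht.not_one_le (h2.le.trans (sup_le ?_ (iSup₂_le fun y hy => ?_)))
  · by_contra h; exact h0 ⟨_, h, residual_mul_le _ _⟩
  · by_contra h; exact hc y hy ⟨_, h, residual_mul_le _ _⟩

/-- Compactness leaves only finitely many multipliers, whose product still avoids the prime `t`. -/
theorem locLE_of_isCompactElement (ht : IsPrimeElement t) (hx : IsCompactElement x)
    {S : Set L} (hS : x ≤ sSup S) (h : ∀ y ∈ S, LocLE t y z) : LocLE t x z := by
  classical
  obtain ⟨T, hT, hxT⟩ := (CompleteLattice.isCompactElement_iff_exists_le_sSup_of_le_sSup L x).1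
    hx S hS
  refine (LocLE.of_le ht hxT).trans ht ?_
  clear hxT
  induction T using Finset.induction_on with
  | empty => exact LocLE.of_le ht (by simp)
  | insert a T ha ih =>
    rw [Finset.sup_insert]
    rw [Finset.coe_insert, Set.insert_subset_iff] at hT
    exact (h a hT.1).sup ht (ih hT.2)

end LocLE

/-- An inequality between a principal and an arbitrary element can be checked at maximal elements. -/
theorem le_of_forall_isCoatom (h1 : IsCompactElement (1 : L)) {x y : L}
    (h : ∀ m, IsCoatom m → LocLE m x y) : x ≤ y := by
  by_cases hr : residual y x = 1
  · have := residual_mul_le y x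
    rwa [hr, one_mul] at this
  · obtain ⟨m, hm, hle⟩ := exists_isCoatom_ge h1 hr
    obtain ⟨s, hs, hsx⟩ := h m hm
    exact absurd ((le_residual.2 hsx).trans hle) hs

/-- Joins of products of principal elements. -/
theorem mul_eq_sSup_isPrincipal (hP : IsPrincipallyGenerated L) (x y : L) :
    x * y = sSup {z | ∃ a b, IsPrincipal a ∧ IsPrincipal b ∧ a ≤ x ∧ b ≤ y ∧ z = a * b} := by
  apply le_antisymm
  · rw [← le_residual]
    refine isPrincipal_le_of_forall hP fun a ha hax => ?_
    rw [le_residual, mul_comm, ← le_residual]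
    refine isPrincipal_le_of_forall hP fun b hb hby => ?_
    rw [le_residual]
    exact le_sSup ⟨a, b, ha, hb, hax, hby, mul_comm _ _⟩
  · refine sSup_le ?_
    rintro _ ⟨a, b, -, -, ha, hb, rfl⟩
    exact mul_le_mul' ha hb

end Basics

/-! ### Locally principal primes and prime factorizations of two-generated elements -/

section PrimeFactorization

variable {L : Type*} [CommMonoid L] [CompleteLattice L] [IsMultiplicativeLattice L]

theorem HasPrimeFactorization.exists_factor {z t : L} (hz : HasPrimeFactorization z)
    (ht : IsPrimeElement t) (hzt : z ≤ t) :
    ∃ p J, IsPrimeElement p ∧ p ≤ t ∧ HasPrimeFactorization J ∧ z = p * J := by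
  obtain ⟨s, hs, rfl⟩ := hz
  obtain ⟨p, hp, hpt⟩ := ht.multiset_prod_le hzt
  obtain ⟨u, rfl⟩ := Multiset.exists_cons_of_mem hp
  exact ⟨p, u.prod, hs p hp, hpt, ⟨u, fun y hy => hs y (Multiset.mem_cons_of_mem hy), rfl⟩,
    Multiset.prod_cons p u⟩

variable (L) in
/-- The join of any two principal elements is a product of prime elements. -/
def SupHasPrimeFactorization : Prop :=
  ∀ a b : L, IsPrincipal a → IsPrincipal b → HasPrimeFactorization (a ⊔ b)

theorem SupHasPrimeFactorization.of_isPrincipal (hF : SupHasPrimeFactorization L) {a : L}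
    (ha : IsPrincipal a) : HasPrimeFactorization a := by simpa using hF a a ha ha

/-- `t` becomes principal after localization at `t`. -/
def IsLocPrincipal (t : L) : Prop := ∃ e J, IsPrincipal e ∧ ¬ J ≤ t ∧ e = t * J

/-- A principal element that is locally not in `t ^ 2` generates `t` locally. -/
theorem isLocPrincipal_of_not_locLE (hP : IsPrincipallyGenerated L)
    (hF : SupHasPrimeFactorization L) {t e : L} (ht : IsPrimeElement t) (he : IsPrincipal e)
    (het : e ≤ t) (h : ¬ LocLE t e (t * t)) : IsLocPrincipal t := by
  have key : ∀ f, IsPrincipal f → f ≤ t →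
      ∃ p J, IsPrimeElement p ∧ p ≤ t ∧ ¬ J ≤ t ∧ e ⊔ f = p * J := by
    intro f hf hft
    obtain ⟨p, J, hp, hpt, -, h1⟩ := (hF e f he hf).exists_factor ht (sup_le het hft)
    refine ⟨p, J, hp, hpt, fun hJ => h (LocLE.of_le ht ?_), h1⟩
    exact le_sup_left.trans (h1.le.trans (mul_le_mul' hpt hJ))
  obtain ⟨p, J, hp, hpt, hJ, h1⟩ := key e he het
  rw [sup_idem] at h1
  rcases eq_or_ne p t with rfl | hne
  · exact ⟨e, J, he, hJ, h1⟩
  obtain ⟨a, ha, hat, hap⟩ := exists_isPrincipal_of_not_le hP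
    (fun h' : t ≤ p => hne (le_antisymm hpt h'))
  -- The prime factor `p'` of `e ⊔ a * a` contains `a` itself, so locally `a` lies below `e ⊔ a *
  -- a`; Nakayama gives `a ≤ e` locally, against `e ≤ p` and `¬ a ≤ p`.
  obtain ⟨p', J', hp', -, hJ', h2⟩ := key (a * a) (ha.mul ha) ((mul_le_left a a).trans hat)
  have h3 : a ≤ p' :=
    (hp'.2 a a (le_sup_right.trans (h2.le.trans (mul_le_left _ _)))).elim id id
  have h4 : J' * a ≤ a * t ⊔ e := by
    calc J' * a ≤ p' * J' := by rw [mul_comm]; exact mul_le_mul_left h3 J'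
      _ = e ⊔ a * a := h2.symm
      _ ≤ a * t ⊔ e := sup_le le_sup_right (le_sup_of_le_left (mul_le_mul_right hat a))
  have h5 := LocLE.of_mul_le_sup ha hJ' h4
  exact absurd (h5.le_of_isPrimeElement hp hpt (h1.le.trans (mul_le_left _ _))) hap

/-- Below a locally principal prime `t`, every properly smaller prime is locally zero. -/
theorem IsLocPrincipal.locLE_bot (hF : SupHasPrimeFactorization L) {t q f : L}
    (hg : IsLocPrincipal t) (hq : IsPrimeElement q) (hqt : q < t)
    (hf : IsPrincipal f) (hfq : f ≤ q) : LocLE t f ⊥ := by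
  obtain ⟨e, J, he, hJ, h⟩ := hg
  -- Since `J * s` is below the principal `e`, it is a multiple of `e`; the cofactor lies in the
  -- prime `s` because `e` does not.
  have key : ∀ s : L, IsPrimeElement s → s < t → J * s ≤ s * e := by
    intro s hs hst
    have hes : ¬ e ≤ s := by
      rw [h]
      exact hs.mul_not_le hst.not_ge fun h' => hJ (h'.trans hst.le)
    have h1 : residual (J * s) e * e = J * s :=
      he.residual_mul_eq (by rw [h, mul_comm]; exact mul_le_mul_left hst.le J)
    have h2 : residual (J * s) e ≤ s :=
      (hs.2 _ _ (h1.le.trans (mul_le_right _ _))).resolve_right hes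
    rw [← h1]
    exact mul_le_mul_left h2 e
  obtain ⟨s, K, hs, hsq, -, hfs⟩ := (hF.of_isPrincipal hf).exists_factor hq hfq
  refine LocLE.bot_of_mul_le hf hJ ?_
  calc J * f = J * s * K := by rw [hfs, mul_assoc]
    _ ≤ s * e * K := mul_le_mul_left (key s hs (hsq.trans_lt hqt)) K
    _ = f * e := by rw [hfs, mul_right_comm]
    _ ≤ f * t := mul_le_mul_right (h.le.trans (mul_le_left _ _)) f

/-- Locally `z` agrees with the `k`-th power of a principal generator of `t`, so lying in the next
power triggers Nakayama. Here `z` itself need not be principal. -/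
theorem IsLocPrincipal.locLE_bot_of_pow_succ {t z R : L} (hg : IsLocPrincipal t)
    (ht : IsPrimeElement t) {k : ℕ} (hz : z = t ^ k * R) (hR : ¬ R ≤ t)
    (h : LocLE t z (t ^ (k + 1))) : LocLE t z ⊥ := by
  obtain ⟨e, J, he, hJ, hej⟩ := hg
  obtain ⟨s, hs, hsz⟩ := h
  have hJk : ∀ k : ℕ, ¬ J ^ k ≤ t := fun k h' => hJ (ht.le_of_pow_le h')
  have h1 : J ^ k * z = e ^ k * R := by rw [hz, hej, mul_pow, ← mul_assoc, mul_comm (J ^ k)]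
  have h2 : LocLE t (e ^ k) ⊥ := by
    refine LocLE.bot_of_mul_le (he.pow k) (ht.mul_not_le hs hR) ?_
    calc s * R * e ^ k = s * z * J ^ k := by
          rw [mul_assoc, mul_comm R, ← h1, mul_comm (J ^ k), mul_assoc]
      _ ≤ t ^ (k + 1) * J ^ k := mul_le_mul_left hsz _
      _ = e ^ k * t := by rw [hej, mul_pow, pow_succ, mul_right_comm]
  obtain ⟨s', hs', h3⟩ := h2
  refine ⟨s' * J ^ k, ht.mul_not_le hs' (hJk k), ?_⟩
  rw [mul_assoc, h1, ← mul_assoc]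
  exact (mul_le_left _ _).trans h3

/-- Splitting off all factors equal to `t` when no factor is properly below `t`. -/
theorem multiset_prod_eq_pow_count_mul [DecidableEq L] {t : L} (ht : IsPrimeElement t)
    {S : Multiset L} (h : ∀ s ∈ S, ¬ s < t) :
    ∃ R, ¬ R ≤ t ∧ S.prod = t ^ S.count t * R := by
  refine ⟨(S.filter (¬ · = t)).prod, fun hle => ?_, ?_⟩
  · obtain ⟨q, hq, hqt⟩ := ht.multiset_prod_le hle
    rw [Multiset.mem_filter] at hq
    exact h q hq.1 (lt_of_le_of_ne hqt hq.2)
  · conv_lhs => rw [← Multiset.filter_add_not (· = t) S, Multiset.prod_add]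
    rw [Multiset.filter_eq', Multiset.prod_replicate]

/-- A locally nonzero principal element is locally a power of the locally principal prime. -/
theorem IsLocPrincipal.exists_eq_pow_mul (hF : SupHasPrimeFactorization L) {t a : L}
    (hg : IsLocPrincipal t) (ht : IsPrimeElement t) (ha : IsPrincipal a)
    (h0 : ¬ LocLE t a ⊥) : ∃ (k : ℕ) (R : L), ¬ R ≤ t ∧ a = t ^ k * R := by
  classical
  obtain ⟨S, hS, rfl⟩ := hF.of_isPrincipal ha
  obtain ⟨R, hR, h⟩ := multiset_prod_eq_pow_count_mul ht (S := S) fun s hs hst =>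
    h0 (hg.locLE_bot hF (hS s hs) hst ha (multiset_prod_le_of_mem hs))
  exact ⟨_, R, hR, h⟩

/-- A form of Krull's intersection theorem: an element that is locally exactly `t ^ k` and lies in
`t ^ (k + 1)` vanishes. -/
theorem IsLocPrincipal.exists_not_locLE_pow (hF : SupHasPrimeFactorization L) {t a : L}
    (hg : IsLocPrincipal t) (ht : IsPrimeElement t) (ha : IsPrincipal a)
    (h0 : ¬ LocLE t a ⊥) : ∃ n : ℕ, ¬ LocLE t a (t ^ n) := by
  obtain ⟨k, R, hR, h⟩ := hg.exists_eq_pow_mul hF ht ha h0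
  exact ⟨k + 1, fun h' => h0 (hg.locLE_bot_of_pow_succ ht h hR h')⟩

/-- Prime factors of a join of two principal elements are locally principal where the join does
not vanish. -/
theorem isLocPrincipal_of_sup_eq_mul (hC : IsCLattice L) (hP : IsPrincipallyGenerated L)
    (hF : SupHasPrimeFactorization L) {p J a c : L} (hp : IsPrimeElement p)
    (ha : IsPrincipal a) (hc : IsPrincipal c) (h : a ⊔ c = p * J) (hc0 : ¬ LocLE p c ⊥) :
    IsLocPrincipal p := by
  by_contra hg
  -- If `p` is not locally principal, every principal element below it is locally in `p * p`; thus
  -- `a ⊔ c` is locally below `p * (a ⊔ c)`.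
  have h1 : LocLE p (a ⊔ c) (p * p * J) := by
    refine locLE_of_isCompactElement hp
      (isCompactElement_sup (ha.isCompactElement hC) (hc.isCompactElement hC))
      (h.trans (mul_eq_sSup_isPrincipal hP p J)).le ?_
    rintro _ ⟨e, y, he, -, hep, hyJ, rfl⟩
    have h2 : LocLE p e (p * p) := by
      by_contra h2
      exact hg (isLocPrincipal_of_not_locLE hP hF hp he hep h2)
    rw [mul_comm e, mul_comm _ J]
    exact (h2.mul_left y).trans hp (LocLE.of_le hp (mul_le_mul_left hyJ _))
  obtain ⟨s, hs, h2⟩ := h1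
  rw [mul_assoc, ← h, Quantale.mul_sup_distrib, Quantale.mul_sup_distrib, sup_le_iff] at h2
  -- Nakayama for two generators: first eliminate `a` in favour of `p * c`, then apply the principal
  -- version to `c`.
  obtain ⟨s', hs', h3⟩ := LocLE.of_mul_le_sup ha hs (y := p * c) (by rw [mul_comm a]; exact h2.1)
  refine hc0 (LocLE.bot_of_mul_le hc (hp.mul_not_le hs' hs) ?_)
  rw [mul_assoc, mul_comm c]
  calc s' * (s * c) ≤ s' * (p * a ⊔ p * c) := mul_le_mul_right h2.2 s'
    _ ≤ p * c := by
      rw [Quantale.mul_sup_distrib]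
      refine sup_le ?_ (mul_le_right _ _)
      rw [mul_left_comm]
      exact (mul_le_mul_right h3 p).trans (mul_le_right _ _)

/-- A principal element that is locally at `M` a prime different from `M` vanishes locally. -/
theorem locLE_bot_of_eq_prime_mul (hC : IsCLattice L) (hP : IsPrincipallyGenerated L)
    (hF : SupHasPrimeFactorization L) {M q R a : L} (hM : IsPrimeElement M)
    (hq : IsPrimeElement q) (hqM : q < M) (ha : IsPrincipal a) (haq : a = q * R)
    (hR : ¬ R ≤ M) : LocLE M a ⊥ := by
  classical
  obtain ⟨c, hc, hcM, hcq⟩ := exists_isPrincipal_of_not_le hP hqM.not_ge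
  have haq' : a ≤ q := haq.le.trans (mul_le_left _ _)
  obtain ⟨S, hS, h1⟩ := hF a c ha hc
  -- The exponent exceeds the multiplicity in `S` of any prime. Where `a` vanishes locally, each
  -- prime of `S` below `M` must therefore occur in `S'` strictly more often than in `S`.
  obtain ⟨S', hS', h2⟩ := hF a (c ^ (S.card + 1)) ha (hc.pow _)
  have hlt : ∀ p ∈ S, p ≤ M → q < p := by
    intro p hp hpM
    have hle : a ⊔ c ≤ p := h1.le.trans (multiset_prod_le_of_mem hp)
    refine lt_of_le_of_ne ?_ fun h => hcq (h ▸ le_sup_right.trans hle)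
    exact ((hS p hp).2 _ _ (haq ▸ le_sup_left.trans hle)).resolve_right
      fun h => hR (h.trans hpM)
  have hcount : ∀ p ∈ S, p ≤ M → S.card + 1 ≤ S'.count p := by
    intro p hp hpM
    have hpp := hS p hp
    have hqp := hlt p hp hpM
    have hg : IsLocPrincipal p := by
      obtain ⟨u, hu⟩ := Multiset.exists_cons_of_mem hp
      refine isLocPrincipal_of_sup_eq_mul hC hP hF hpp ha hc (J := u.prod)
        (by rw [h1, hu, Multiset.prod_cons]) fun h => hcq ?_
      exact h.le_of_isPrimeElement hq hqp.le bot_le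
    have hcz : ¬ LocLE p (c ^ (S.card + 1)) ⊥ := fun h =>
      hcq (hq.le_of_pow_le (h.le_of_isPrimeElement hq hqp.le bot_le))
    obtain ⟨K, hK, h3⟩ := multiset_prod_eq_pow_count_mul hpp (S := S') fun s hs hsp =>
      hcz (hg.locLE_bot hF (hS' s hs) hsp (hc.pow _)
        (le_sup_right.trans (h2.le.trans (multiset_prod_le_of_mem hs))))
    by_contra! hlt'
    have hcp : c ≤ p := le_sup_right.trans (h1.le.trans (multiset_prod_le_of_mem hp))
    have h4 : LocLE p (a ⊔ c ^ (S.card + 1)) (p ^ (S'.count p + 1)) := by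
      refine LocLE.sup hpp ((hg.locLE_bot hF hq hqp ha haq').trans hpp
        (LocLE.of_le hpp bot_le)) (LocLE.of_le hpp ?_)
      exact (pow_le_pow_left' hcp _).trans
        (pow_le_pow_right_of_le_one' (le_one' p) hlt')
    exact hcz ((LocLE.of_le hpp le_sup_right).trans hpp
      (hg.locLE_bot_of_pow_succ hpp (h2.trans h3) hK h4))
  obtain ⟨p₀, hp₀, hp₀M⟩ := hM.multiset_prod_le
    (h1 ▸ sup_le (haq'.trans hqM.le) hcM)
  -- The extra factor `p₀` yields, locally at `M`, `a ≤ p₀ * (a ⊔ c)`, from which Nakayama extracts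
  -- `a ≤ c`.
  have h3 : p₀ ::ₘ S.filter (· ≤ M) ≤ S' := by
    rw [Multiset.le_iff_count]
    intro p
    by_cases hp : p ∈ S.filter (· ≤ M)
    · have hp' := Multiset.mem_filter.1 hp
      refine le_trans ?_ (hcount p hp'.1 hp'.2)
      refine (Multiset.count_le_card _ _).trans ?_
      rw [Multiset.card_cons]
      exact Nat.succ_le_succ (Multiset.card_le_card (Multiset.filter_le _ _))
    · rw [Multiset.count_cons_of_ne, Multiset.count_eq_zero_of_notMem hp]
      · exact Nat.zero_le _
      · rintro rfl
        exact hp (Multiset.mem_filter.2 ⟨hp₀, hp₀M⟩)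
  obtain ⟨U, rfl⟩ := Multiset.le_iff_exists_add.1 h3
  set K := (S.filter (¬ · ≤ M)).prod with hKdef
  have hK : ¬ K ≤ M := fun h => by
    obtain ⟨p, hp, hpM⟩ := hM.multiset_prod_le h
    exact (Multiset.mem_filter.1 hp).2 hpM
  have h4 : (S.filter (· ≤ M)).prod * K = a ⊔ c := by
    rw [hKdef, ← Multiset.prod_add, Multiset.filter_add_not, h1]
  have h5 : K * a ≤ a * M ⊔ c := by
    calc K * a ≤ K * (p₀ * (S.filter (· ≤ M)).prod) := by
          refine mul_le_mul_right (le_sup_left.trans (h2.le.trans ?_)) K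
          rw [Multiset.prod_add, Multiset.prod_cons]
          exact mul_le_left _ _
      _ = (a ⊔ c) * p₀ := by rw [← h4, mul_comm, mul_assoc, mul_comm]
      _ ≤ a * M ⊔ c := by
        rw [Quantale.sup_mul_distrib]
        exact sup_le_sup (mul_le_mul_right hp₀M a) (mul_le_left _ _)
  obtain ⟨s, hs, h6⟩ := LocLE.of_mul_le_sup ha hK h5
  have h7 := hc.residual_mul_eq h6
  -- Thus `s * a` is `c` times something in `q`. As `q` is locally `a`, this puts `a` in `a * c ≤ a
  -- * M`, and Nakayama applies again.
  have h8 : residual (s * a) c ≤ q :=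
    (hq.2 _ _ (h7.le.trans ((mul_le_right _ _).trans haq'))).resolve_right hcq
  refine LocLE.bot_of_mul_le ha (hM.mul_not_le hR hs) ?_
  calc R * s * a = R * (residual (s * a) c * c) := by rw [h7, mul_assoc]
    _ ≤ R * (q * c) := mul_le_mul_right (mul_le_mul_left h8 c) R
    _ = a * c := by rw [haq, ← mul_assoc, mul_comm R]
    _ ≤ a * M := mul_le_mul_right hcM a

/-- In `a = p * J` with `p ≤ M`, a cofactor outside `M` would make `M` locally principal (if `p =
M`) or `a` locally zero (if `p < M`). So `a` is a join of products from `M`, and local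
join-irreducibility picks one of them. -/
theorem exists_locLE_mul_of_not_isLocPrincipal (hC : IsCLattice L)
    (hP : IsPrincipallyGenerated L) (hF : SupHasPrimeFactorization L) {M a : L}
    (hM : IsPrimeElement M) (hg : ¬ IsLocPrincipal M) (ha : IsPrincipal a) (haM : a ≤ M)
    (h0 : ¬ LocLE M a ⊥) :
    ∃ x y, IsPrincipal x ∧ IsPrincipal y ∧ x ≤ M ∧ y ≤ M ∧ LocLE M a (x * y) := by
  obtain ⟨p, J, hp, hpM, -, h⟩ := (hF.of_isPrincipal ha).exists_factor hM haM
  have hJ : J ≤ M := by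
    by_contra hJ
    rcases hpM.eq_or_lt with rfl | hlt
    · exact hg ⟨a, J, ha, hJ, h⟩
    · exact h0 (locLE_bot_of_eq_prime_mul hC hP hF hM hp hlt ha h hJ)
  obtain ⟨_, ⟨x, y, hx, hy, hxp, hyJ, rfl⟩, h1⟩ :=
    exists_locLE_of_eq_sSup hM ha h0 (h.trans (mul_eq_sSup_isPrincipal hP p J))
  exact ⟨x, y, hx, hy, hxp.trans hpM, hyJ.trans hJ, h1⟩

theorem exists_locLE_prod_of_not_isLocPrincipal (hC : IsCLattice L)
    (hP : IsPrincipallyGenerated L) (hF : SupHasPrimeFactorization L) {M a : L}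
    (hM : IsPrimeElement M) (hg : ¬ IsLocPrincipal M) (ha : IsPrincipal a) (haM : a ≤ M)
    (h0 : ¬ LocLE M a ⊥) (n : ℕ) :
    ∃ S : Multiset L, S.card = n + 1 ∧ (∀ b ∈ S, IsPrincipal b ∧ b ≤ M) ∧
      LocLE M a S.prod := by
  induction n with
  | zero => exact ⟨{a}, by simp, by simp [ha, haM], by simpa using LocLE.of_le hM le_rfl⟩
  | succ n ih =>
    obtain ⟨S, hcard, hS, h⟩ := ih
    obtain ⟨b, hb⟩ : ∃ b, b ∈ S := Multiset.card_pos_iff_exists_mem.1 (by omega)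
    obtain ⟨T, rfl⟩ := Multiset.exists_cons_of_mem hb
    have hb0 : ¬ LocLE M b ⊥ := fun h' => h0 <| h.trans hM <|
      (LocLE.of_le hM (multiset_prod_le_of_mem hb)).trans hM h'
    obtain ⟨x, y, hx, hy, hxM, hyM, hxy⟩ := exists_locLE_mul_of_not_isLocPrincipal hC hP hF hM hg
      (hS b hb).1 (hS b hb).2 hb0
    refine ⟨x ::ₘ y ::ₘ T, by simpa using hcard, ?_, ?_⟩
    · intro z hz
      rcases Multiset.mem_cons.1 hz with rfl | hz
      · exact ⟨hx, hxM⟩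
      rcases Multiset.mem_cons.1 hz with rfl | hz
      · exact ⟨hy, hyM⟩
      · exact hS z (Multiset.mem_cons_of_mem hz)
    · refine h.trans hM ?_
      rw [Multiset.prod_cons, Multiset.prod_cons, Multiset.prod_cons, ← mul_assoc,
        mul_comm b, mul_comm (x * y)]
      exact hxy.mul_left T.prod

end PrimeFactorization

/-! ### From two-generated elements to ZPI-lattices -/

section ZPI

variable {L : Type*} [CommMonoid L] [CompleteLattice L] [IsMultiplicativeLattice L]

/-- A prime element that is not locally principal is locally zero. -/
theorem locLE_bot_of_not_isLocPrincipal (hC : IsCLattice L) (hP : IsPrincipallyGenerated L)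
    (hF : SupHasPrimeFactorization L) {M : L} (hM : IsPrimeElement M)
    (hg : ¬ IsLocPrincipal M) {a₀ : L} (ha₀ : IsPrincipal a₀) (ha₀M : a₀ ≤ M) :
    LocLE M a₀ ⊥ := by
  classical
  by_contra h0
  obtain ⟨F, hFp, hF0⟩ := hF.of_isPrincipal (isPrincipal_bot (L := L))
  let Q : L → Prop := fun b => IsPrincipal b ∧ b ≤ M ∧ ¬ LocLE M b ⊥
  let I : L → Finset L := fun b => F.toFinset.filter fun P => P ≤ M ∧ b ≤ P
  have hI : ∀ {b P}, P ∈ I b ↔ P ∈ F ∧ P ≤ M ∧ b ≤ P := by simp [I]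
  -- By minimality, replacing `a` by any locally larger element of `Q`, in particular by a factor
  -- from a local splitting, does not change the set of prime factors of `0` above it.
  obtain ⟨a, haQ, hmin⟩ : ∃ a, Q a ∧ ∀ b, Q b → (I a).card ≤ (I b).card := by
    have hne : ((fun b => (I b).card) '' {b | Q b}).Nonempty := ⟨_, a₀, ⟨ha₀, ha₀M, h0⟩, rfl⟩
    obtain ⟨a, ha, h⟩ := Nat.sInf_mem hne
    exact ⟨a, ha, fun b hb => h.trans_le (Nat.sInf_le ⟨b, hb, rfl⟩)⟩
  have hIeq : ∀ c, Q c → LocLE M a c → I c = I a := fun c hc hac =>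
    Finset.eq_of_subset_of_card_le (fun P hPc => by
      rw [hI] at hPc ⊢
      exact ⟨hPc.1, hPc.2.1, hac.le_of_isPrimeElement (hFp P hPc.1) hPc.2.1 hPc.2.2⟩) (hmin c hc)
  have hsplit : ∀ b, Q b → LocLE M a b → ∀ n : ℕ, ∃ S : Multiset L, S.card = n + 1 ∧
      (∀ c ∈ S, Q c ∧ LocLE M a c) ∧ LocLE M b S.prod := by
    intro b hb hab n
    obtain ⟨S, hcard, hS, h⟩ :=
      exists_locLE_prod_of_not_isLocPrincipal hC hP hF hM hg hb.1 hb.2.1 hb.2.2 n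
    have hbc : ∀ c ∈ S, LocLE M b c := fun c hc =>
      h.trans hM (LocLE.of_le hM (multiset_prod_le_of_mem hc))
    exact ⟨S, hcard, fun c hc => ⟨⟨(hS c hc).1, (hS c hc).2,
      fun h' => hb.2.2 ((hbc c hc).trans hM h')⟩, hab.trans hM (hbc c hc)⟩, h⟩
  have hbelow : ∀ p, IsPrimeElement p → ∃ P ∈ F, P ≤ p := fun p hp =>
    hp.multiset_prod_le (hF0 ▸ bot_le)
  have hfactor : ∀ b, Q b → LocLE M a b → ∀ S : Multiset L, (∀ y ∈ S, IsPrimeElement y) →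
      b = S.prod → ∀ s ∈ S, s ≤ M → (∀ P ∈ I a, ¬ P ≤ s) →
        ¬ LocLE s a ⊥ ∧ IsLocPrincipal s := by
    intro b hb hab S hS hbS s hs hsM hPs
    obtain ⟨P, hPF, hPs'⟩ := hbelow s (hS s hs)
    have hbP : ∀ c, I c = I a → ¬ LocLE s c ⊥ := fun c hc h =>
      hPs P (hc ▸ hI.2 ⟨hPF, hPs'.trans hsM, h.le_of_isPrimeElement (hFp P hPF) hPs' bot_le⟩) hPs'
    obtain ⟨T, rfl⟩ := Multiset.exists_cons_of_mem hs
    exact ⟨hbP a rfl, isLocPrincipal_of_sup_eq_mul hC hP hF (hS s hs) isPrincipal_bot hb.1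
      (J := T.prod) (by rw [bot_sup_eq, hbS, Multiset.prod_cons]) (hbP b (hIeq b hb hab))⟩
  have haa : LocLE M a a := LocLE.of_le hM le_rfl
  obtain ⟨S, hS, haS⟩ := hF.of_isPrincipal haQ.1
  -- The element is enlarged locally to escape the primes of `T` one by one: `a` is not locally in
  -- `t ^ n`, so among `n + 1` factors of a splitting at least one is outside `t`.
  have hremove : ∀ T : Finset L, (∀ t ∈ T, t ∈ S ∧ t ≤ M ∧ ∀ P ∈ I a, ¬ P ≤ t) →
      ∃ b, Q b ∧ LocLE M a b ∧ ∀ t ∈ T, ¬ b ≤ t := by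
    intro T
    induction T using Finset.induction_on with
    | empty => exact fun _ => ⟨a, haQ, haa, by simp⟩
    | insert t T _ ih =>
      intro hT
      obtain ⟨b, hb, hab, hbT⟩ := ih fun t ht => hT t (Finset.mem_insert_of_mem ht)
      obtain ⟨htS, htM, htP⟩ := hT t (Finset.mem_insert_self t T)
      obtain ⟨hat, htg⟩ := hfactor a haQ haa S hS haS t htS htM htP
      obtain ⟨n, hn⟩ := htg.exists_not_locLE_pow hF (hS t htS) haQ.1 hat
      obtain ⟨U, hUcard, hU, hbU⟩ := hsplit b hb hab n
      obtain ⟨c, hcU, hct⟩ : ∃ c ∈ U, ¬ c ≤ t := by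
        by_contra! hc
        refine hn (((hab.trans hM hbU).mono htM).trans (hS t htS) (LocLE.of_le (hS t htS) ?_))
        refine (multiset_prod_le_pow hc).trans ?_
        rw [hUcard, pow_succ]
        exact mul_le_left _ _
      have hbc : LocLE M b c := hbU.trans hM (LocLE.of_le hM (multiset_prod_le_of_mem hcU))
      refine ⟨c, (hU c hcU).1, (hU c hcU).2, fun u hu => ?_⟩
      rcases Finset.mem_insert.1 hu with rfl | hu'
      · exact hct
      · have := hT u hu
        exact fun h => hbT u hu' (hbc.le_of_isPrimeElement (hS u this.1) this.2.1 h)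
  obtain ⟨b, hb, hab, hbT⟩ := hremove
    (S.toFinset.filter fun t => t ≤ M ∧ ∀ P ∈ I a, ¬ P ≤ t) (by simp)
  obtain ⟨U, hU, hbU⟩ := hF.of_isPrincipal hb.1
  -- A bad factor `s` of `b` contains some factor `t` of `a`. The element `b` avoids `t`, so `t <
  -- s`, and then `a` vanishes at the locally principal `s`.
  have hUP : ∀ s ∈ U, s ≤ M → ∃ P ∈ I a, P ≤ s := by
    intro s hs hsM
    by_contra! hPs
    obtain ⟨has, hsg⟩ := hfactor b hb hab U hU hbU s hs hsM hPs
    have hbs : b ≤ s := hbU.le.trans (multiset_prod_le_of_mem hs)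
    have has' : a ≤ s := hab.le_of_isPrimeElement (hU s hs) hsM hbs
    obtain ⟨t, htS, hts⟩ := (hU s hs).multiset_prod_le (haS ▸ has')
    have htb : ¬ b ≤ t := hbT t (by
      simp only [Finset.mem_filter, Multiset.mem_toFinset]
      exact ⟨htS, hts.trans hsM, fun P hPI hPt => hPs P hPI (hPt.trans hts)⟩)
    refine has (hsg.locLE_bot hF (hS t htS) (lt_of_le_of_ne hts ?_) haQ.1
      (haS.le.trans (multiset_prod_le_of_mem htS)))
    rintro rfl
    exact htb hbs
  set q := (I a).inf id with hq
  have hqM : q ≤ M := by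
    obtain ⟨s, hs, hsM⟩ := hM.multiset_prod_le (hbU ▸ hb.2.1)
    obtain ⟨P, hPI, hPs⟩ := hUP s hs hsM
    exact (Finset.inf_le hPI).trans (hPs.trans hsM)
  set V := U.filter (· ≤ M) with hV
  set K := (U.filter (¬ · ≤ M)).prod with hKdef
  have hK : ¬ K ≤ M := fun h => by
    obtain ⟨p, hp, hpM⟩ := hM.multiset_prod_le h
    exact (Multiset.mem_filter.1 hp).2 hpM
  have hVK : K * V.prod = b := by
    rw [hKdef, hV, mul_comm, ← Multiset.prod_add, Multiset.filter_add_not, hbU]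
  have hqV : q ^ V.card ≤ V.prod := pow_le_multiset_prod fun s hs => by
    obtain ⟨hsU, hsM⟩ := Multiset.mem_filter.1 hs
    obtain ⟨P, hPI, hPs⟩ := hUP s hsU hsM
    exact (Finset.inf_le hPI).trans hPs
  -- Locally `b` contains `q ^ V.card`, while a splitting into one factor more, each below `q`, puts
  -- `b` in `q ^ (V.card + 1)`; Nakayama forces `b` to vanish.
  obtain ⟨W, hWcard, hW, s, hs, hsb⟩ := hsplit b hb hab V.card
  have hWq : W.prod ≤ q ^ (V.card + 1) := by
    rw [← hWcard]
    refine multiset_prod_le_pow fun c hc => Finset.le_inf fun P hPI => ?_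
    rw [← hIeq c (hW c hc).1 (hW c hc).2, hI] at hPI
    exact hPI.2.2
  refine hb.2.2 (LocLE.bot_of_mul_le hb.1 (hM.mul_not_le hK hs) ?_)
  calc K * s * b ≤ K * q ^ (V.card + 1) := by
        rw [mul_assoc]; exact mul_le_mul_right (hsb.trans hWq) K
    _ = K * q ^ V.card * q := by rw [pow_succ, mul_assoc]
    _ ≤ b * M := mul_le_mul' ((mul_le_mul_right hqV K).trans hVK.le) hqM

/-- If joins of two principal elements are products of primes, then so are all elements. -/
theorem isZPILattice_of_supHasPrimeFactorization (hC : IsCLattice L)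
    (hP : IsPrincipallyGenerated L) (hF : SupHasPrimeFactorization L) : IsZPILattice L := by
  classical
  intro x
  have h1 := hC.isCompactElement_one
  obtain ⟨F, hFp, hF0⟩ := hF.of_isPrincipal (isPrincipal_bot (L := L))
  have hzero : ∀ M : L, IsCoatom M → ∀ p : L, IsPrimeElement p → p < M → ∀ e : L, IsPrincipal e → e ≤ p →
      LocLE M e ⊥ := by
    intro M hM p hp hpM e he hep
    by_cases hg : IsLocPrincipal M
    · exact hg.locLE_bot hF hp hpM he hep
    · exact locLE_bot_of_not_isLocPrincipal hC hP hF (isPrimeElement_of_isCoatom hM) hg he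
        (hep.trans hpM.le)
  -- At a maximal element above `x` but outside `A`, some prime factor of `0` above `x` is properly
  -- smaller, so `x` vanishes there. Only `A` needs local exponents.
  let A : Set L := {M | IsCoatom M ∧ x ≤ M ∧ ∀ P ∈ F, x ≤ P → ¬ P < M}
  have hAfin : A.Finite := by
    have hT : ∀ P : L, ∃ T : Finset L, ∀ M ∈ A, P ∈ F → P < M → M ∈ T := by
      intro P
      by_cases hxP : x ≤ P
      · exact ⟨∅, fun M hM hPF hPM => absurd hPM (hM.2.2 P hPF hxP)⟩
      obtain ⟨y, hy, hyx, hyP⟩ := exists_isPrincipal_of_not_le hP hxP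
      obtain ⟨S, hS, hyS⟩ := hF.of_isPrincipal hy
      refine ⟨S.toFinset, fun M hM hPF hPM => ?_⟩
      obtain ⟨s, hs, hsM⟩ := (isPrimeElement_of_isCoatom hM.1).multiset_prod_le
        (hyS ▸ hyx.trans hM.2.1)
      rcases hsM.eq_or_lt with rfl | hlt
      · exact Multiset.mem_toFinset.2 hs
      · have := hzero M hM.1 s (hS s hs) hlt y hy (hyS.le.trans (multiset_prod_le_of_mem hs))
        exact absurd (this.le_of_isPrimeElement (hFp P hPF) hPM.le bot_le) hyP
    choose T hT using hT
    refine (F.toFinset ∪ F.toFinset.biUnion T).finite_toSet.subset fun M hM => ?_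
    obtain ⟨P, hPF, hPM⟩ := (isPrimeElement_of_isCoatom hM.1).multiset_prod_le
      (show F.prod ≤ M from hF0 ▸ bot_le)
    rw [Finset.mem_coe, Finset.mem_union, Finset.mem_biUnion]
    rcases hPM.eq_or_lt with rfl | hlt
    · exact Or.inl (Multiset.mem_toFinset.2 hPF)
    · exact Or.inr ⟨P, Multiset.mem_toFinset.2 hPF, hT P M hM hPF hlt⟩
  have hv : ∀ M : L, ∃ v : ℕ, M ∈ A → (∀ y, IsPrincipal y → y ≤ M ^ v → LocLE M y x) ∧
      ∀ y, IsPrincipal y → y ≤ x → LocLE M y (M ^ v) := by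
    intro M
    by_cases hMA : M ∈ A
    swap
    · exact ⟨0, fun h => absurd h hMA⟩
    have hM := isPrimeElement_of_isCoatom hMA.1
    by_cases hg : IsLocPrincipal M
    swap
    · refine ⟨1, fun _ => ⟨fun y hy hyM => ?_, fun y hy hyx => LocLE.of_le hM ?_⟩⟩
      · rw [pow_one] at hyM
        exact (locLE_bot_of_not_isLocPrincipal hC hP hF hM hg hy hyM).trans hM
          (LocLE.of_le hM bot_le)
      · rw [pow_one]; exact hyx.trans hMA.2.1
    by_cases hx0 : ∀ y, IsPrincipal y → y ≤ x → LocLE M y ⊥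
    · obtain ⟨R, hR, h⟩ := multiset_prod_eq_pow_count_mul hM (S := F) fun P hPF hPM =>
        hMA.2.2 P hPF (isPrincipal_le_of_forall hP fun y hy hyx =>
          (hx0 y hy hyx).le_of_isPrimeElement (hFp P hPF) hPM.le bot_le) hPM
      -- Here `x` is locally zero, and so is `M ^ F.count M`, because the other factors of `0` are
      -- outside `M`.
      refine ⟨F.count M, fun _ => ⟨fun y hy hyM => ⟨R, hR, ?_⟩, fun y hy hyx =>
        (hx0 y hy hyx).trans hM (LocLE.of_le hM bot_le)⟩⟩
      calc R * y ≤ R * M ^ F.count M := mul_le_mul_right hyM R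
        _ = ⊥ := by rw [mul_comm, ← h, hF0]
        _ ≤ x := bot_le
    · push Not at hx0
      obtain ⟨y₀, hy₀, hy₀x, hy₀0⟩ := hx0
      have hex : ∃ k : ℕ, ∃ y R, y ≤ x ∧ ¬ R ≤ M ∧ y = M ^ k * R := by
        obtain ⟨k, R, hR, h⟩ := hg.exists_eq_pow_mul hF hM hy₀ hy₀0
        exact ⟨k, y₀, R, hy₀x, hR, h⟩
      refine ⟨Nat.find hex, fun _ => ⟨fun y hy hyM => ?_, fun y hy hyx => ?_⟩⟩
      · obtain ⟨z, R, hzx, hR, hz⟩ := Nat.find_spec hex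
        refine ⟨R, hR, le_trans ?_ hzx⟩
        conv_rhs => rw [hz, mul_comm]
        exact mul_le_mul_right hyM R
      · by_cases hy0 : LocLE M y ⊥
        · exact hy0.trans hM (LocLE.of_le hM bot_le)
        · obtain ⟨k, R, hR, h⟩ := hg.exists_eq_pow_mul hF hM hy hy0
          refine LocLE.of_le hM (h.le.trans ((mul_le_left _ _).trans ?_))
          exact pow_le_pow_right_of_le_one' (le_one' M) (Nat.find_min' hex ⟨y, R, hyx, hR, h⟩)
  choose v hv using hv
  set B : Finset L := F.toFinset.filter fun P => x ≤ P ∧ ¬ IsCoatom P with hBdef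
  have hB : ∀ {P}, P ∈ B ↔ P ∈ F ∧ x ≤ P ∧ ¬ IsCoatom P := by simp [hBdef]
  have hmemA : ∀ {M}, M ∈ hAfin.toFinset ↔ M ∈ A := hAfin.mem_toFinset
  -- The factors in `B` make `X` vanish at the maximal elements above `x` outside `A`, and are
  -- locally trivial at those in `A`.
  set X := (∏ P ∈ B, P) * ∏ M ∈ hAfin.toFinset, M ^ v M with hX
  have hXA : ∀ N ∈ A, X ≤ N ^ v N := fun N hN =>
    (mul_le_right _ _).trans (finset_prod_le_of_mem (fun M => M ^ v M) (hmemA.2 hN))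
  have hnotA : ∀ N, IsCoatom N → x ≤ N → N ∉ A → ∃ P ∈ F, x ≤ P ∧ P < N := by
    intro N hN hxN hNA
    by_contra! h
    exact hNA ⟨hN, hxN, h⟩
  have hXx : x = X := by
    apply le_antisymm
    · refine isPrincipal_le_of_forall hP fun y hy hyx => le_of_forall_isCoatom h1 fun N hN => ?_
      have hNp := isPrimeElement_of_isCoatom hN
      by_cases hxN : x ≤ N
      swap
      · refine ⟨X, fun h => ?_, mul_le_left _ _⟩
        rcases hNp.2 _ _ h with h | h
        · obtain ⟨P, hPB, hPN⟩ := hNp.finset_prod_le h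
          exact hxN ((hB.1 hPB).2.1.trans hPN)
        · obtain ⟨M, hM, hMN⟩ := hNp.finset_prod_le h
          exact hxN ((hmemA.1 hM).2.1.trans (hNp.le_of_pow_le hMN))
      by_cases hNA : N ∈ A
      · obtain ⟨s, hs, hsy⟩ := (hv N hNA).2 y hy hyx
        refine ⟨(∏ P ∈ B, P) * (∏ M ∈ hAfin.toFinset.erase N, M ^ v M) * s,
          hNp.mul_not_le (hNp.mul_not_le (fun h => ?_) fun h => ?_) hs, ?_⟩
        · obtain ⟨P, hPB, hPN⟩ := hNp.finset_prod_le h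
          have hPB' := hB.1 hPB
          refine hNA.2.2 P hPB'.1 hPB'.2.1 (lt_of_le_of_ne hPN ?_)
          rintro rfl
          exact hPB'.2.2 hN
        · obtain ⟨M, hM, hMN⟩ := hNp.finset_prod_le h
          rw [Finset.mem_erase, hmemA] at hM
          exact hM.1 ((hM.2.1.le_iff.1 (hNp.le_of_pow_le hMN)).elim
            (fun h => absurd h hN.1) Eq.symm)
        · rw [hX, ← Finset.prod_erase_mul _ _ (hmemA.2 hNA), ← mul_assoc, mul_assoc _ s]
          exact mul_le_mul_right hsy _
      · obtain ⟨P, hPF, hxP, hPN⟩ := hnotA N hN hxN hNA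
        exact (hzero N hN P (hFp P hPF) hPN y hy (hyx.trans hxP)).trans hNp
          (LocLE.of_le hNp bot_le)
    · refine isPrincipal_le_of_forall hP fun y hy hyX => le_of_forall_isCoatom h1 fun N hN => ?_
      have hNp := isPrimeElement_of_isCoatom hN
      by_cases hxN : x ≤ N
      swap
      · exact ⟨x, hxN, mul_le_left _ _⟩
      by_cases hNA : N ∈ A
      · exact (hv N hNA).1 y hy (hyX.trans (hXA N hNA))
      · obtain ⟨P, hPF, hxP, hPN⟩ := hnotA N hN hxN hNA
        have hPB : P ∈ B := hB.2 ⟨hPF, hxP, fun hPc =>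
          (isCoatom_lt_one hN).ne ((hPc.2 N hPN).trans IsMultiplicativeLattice.one_eq_top.symm)⟩
        have hyP : y ≤ P := hyX.trans ((mul_le_left _ _).trans
          (finset_prod_le_of_mem (fun P => P) hPB))
        exact (hzero N hN P (hFp P hPF) hPN y hy hyP).trans hNp (LocLE.of_le hNp bot_le)
  rw [hXx]
  refine HasPrimeFactorization.mul ?_ ?_
  · exact hasPrimeFactorization_finset_prod _ _ fun P hPB =>
      (hFp P (hB.1 hPB).1).hasPrimeFactorization
  · exact hasPrimeFactorization_finset_prod _ _ fun M hM =>
      (isPrimeElement_of_isCoatom (hmemA.1 hM).1).hasPrimeFactorization.pow _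

end ZPI

/-! ### OA-elements -/

section OA

variable {L : Type*} [CommMonoid L] [CompleteLattice L] [IsMultiplicativeLattice L]

theorem IsPrimeElement.isOAElement {p : L} (hp : IsPrimeElement p) : IsOAElement p :=
  ⟨hp.1, fun _ _ _ _ _ _ h => hp.2 _ _ h⟩

theorem isOAElement_of_sq_le {m x : L} (hm : ∀ y : L, y ≠ 1 → y ≤ m) (hx : x ≠ 1)
    (h : m ^ 2 ≤ x) : IsOAElement x := by
  refine ⟨lt_one_iff.2 hx, fun a b c ha hb _ _ => Or.inl (le_trans ?_ h)⟩
  rw [sq]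
  exact mul_le_mul' (hm a ha) (hm b hb)

/-- If `a * b ≤ x` with neither factor below `x`, absorption gives `c * a ≤ x` for every proper `c`.
Two proper elements joining to `1` would then give `a ≤ x`, so there is one maximal `m`; absorbing
`a` from `m * m * a ≤ x` leaves `m ^ 2 ≤ x`. -/
theorem IsOAElement.isPrimeElement_or {x : L} (h1 : IsCompactElement (1 : L))
    (hx : IsOAElement x) :
    IsPrimeElement x ∨ ∃ m, IsCoatom m ∧ (∀ y : L, y ≠ 1 → y ≤ m) ∧ m ^ 2 ≤ x := by
  by_cases hp : IsPrimeElement x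
  · exact Or.inl hp
  right
  obtain ⟨a, b, hab, ha, hb⟩ : ∃ a b, a * b ≤ x ∧ ¬ a ≤ x ∧ ¬ b ≤ x := by
    by_contra! h
    exact hp ⟨hx.1, fun a b hab => or_iff_not_imp_left.2 (h a b hab)⟩
  have ha1 : a ≠ 1 := by
    rintro rfl
    exact hb (by rwa [one_mul] at hab)
  have hb1 : b ≠ 1 := by
    rintro rfl
    exact ha (by rwa [mul_one] at hab)
  have hca : ∀ c : L, c ≠ 1 → c * a ≤ x := fun c hc =>
    (hx.2 c a b hc ha1 hb1
      (by rw [mul_assoc]; exact (mul_le_right _ _).trans hab)).resolve_right hb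
  obtain ⟨m, hm, -⟩ := exists_isCoatom_ge h1 hx.1.ne
  have hmax : ∀ y : L, y ≠ 1 → y ≤ m := by
    intro y hy
    by_contra hym
    have h2 : (m ⊔ y) * a ≤ x := by
      rw [Quantale.sup_mul_distrib]
      exact sup_le (hca m (isCoatom_lt_one hm).ne) (hca y hy)
    rw [isCoatom_sup_eq_one hm hym, one_mul] at h2
    exact ha h2
  refine ⟨m, hm, hmax, ?_⟩
  have hm1 := (isCoatom_lt_one hm).ne
  rw [sq]
  exact (hx.2 m m a hm1 hm1 ha1
    (by rw [mul_assoc]; exact (mul_le_right _ _).trans (hca m hm1))).resolve_right ha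

theorem HasOAFactorization.mul {x y : L} (hx : HasOAFactorization x)
    (hy : HasOAFactorization y) : HasOAFactorization (x * y) := by
  obtain ⟨s, hs, rfl⟩ := hx
  obtain ⟨t, ht, rfl⟩ := hy
  exact ⟨s + t, fun y hy => (Multiset.mem_add.1 hy).elim (hs y) (ht y),
    (Multiset.prod_add s t).symm⟩

theorem hasOAFactorization_one : HasOAFactorization (1 : L) := ⟨0, by simp, by simp⟩

theorem IsOAElement.hasOAFactorization {x : L} (hx : IsOAElement x) : HasOAFactorization x :=
  ⟨{x}, by simpa using hx, by simp⟩

theorem HasOAFactorization.pow {x : L} (hx : HasOAFactorization x) (n : ℕ) :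
    HasOAFactorization (x ^ n) := by
  induction n with
  | zero => simpa using hasOAFactorization_one
  | succ n ih => rw [pow_succ]; exact ih.mul hx

/-! ### The quasi-local case -/

section Local

variable {m : L}

theorem LocLE.le_of_isMax (hmax : ∀ y : L, y ≠ 1 → y ≤ m) {x y : L} (h : LocLE m x y) :
    x ≤ y := by
  obtain ⟨s, hs, h⟩ := h
  have hs1 : s = 1 := by_contra fun h1 => hs (hmax s h1)
  rwa [hs1, one_mul] at h

/-- If `m ^ 2` lies below a principal element `e` not in `m ^ 2`, the powers of `m` are
controlled by those of `e`. -/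
theorem pow_succ_eq_mul_pow (hmax : ∀ y : L, y ≠ 1 → y ≤ m) {e : L} (he : IsPrincipal e)
    (hem : e ≤ m) (he2 : ¬ e ≤ m ^ 2) (h : m ^ 2 ≤ e) (k : ℕ) : m ^ (k + 1) = m * e ^ k := by
  -- As `m ^ 2 ≤ e`, it is `e` times a cofactor, which is proper because `e` is not below `m ^ 2`.
  have h2 : m ^ 2 = m * e := by
    have h3 := he.residual_mul_eq h
    have h4 : residual (m ^ 2) e ≠ 1 := fun h4 => he2 (by rw [h4, one_mul] at h3; exact h3.le)
    refine le_antisymm ?_ (by rw [sq]; exact mul_le_mul_right hem m)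
    conv_lhs => rw [← h3]
    exact mul_le_mul_left (hmax _ h4) e
  induction k with
  | zero => simp
  | succ k ih => rw [pow_succ, ih, mul_right_comm, ← sq, h2, pow_succ', mul_assoc]

/-- Proper elements not below `m ^ 2` contain it, hence are OA. An element below `m ^ 2` is divided
repeatedly by `e` until the cofactor leaves `m ^ 2`; if this never happens it lies in every `m ^ n`.
The hypotheses on `⊥` and on the powers of `m` are what the nilpotent and the domain case share. -/
theorem isOAFL_of_isComparable_sq (hP : IsPrincipallyGenerated L)
    (hmax : ∀ y : L, y ≠ 1 → y ≤ m) (hm1 : m ≠ 1) (hcomp : IsComparable (m ^ 2))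
    (hbot : HasOAFactorization (⊥ : L)) (hinf : ∀ x : L, (∀ n : ℕ, x ≤ m ^ n) → x = ⊥) :
    IsOAFL L := by
  have hoa : ∀ y : L, y ≠ 1 → ¬ y ≤ m ^ 2 → HasOAFactorization y := fun y hy hy2 =>
    (isOAElement_of_sq_le hmax hy ((hcomp y).resolve_right hy2)).hasOAFactorization
  intro x
  rcases eq_or_ne x 1 with rfl | hx1
  · exact hasOAFactorization_one
  by_cases hx2 : x ≤ m ^ 2
  swap
  · exact hoa x hx1 hx2
  by_cases hmm : m ≤ m ^ 2
  · have hmn : ∀ n : ℕ, m ≤ m ^ n := by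
      intro n
      induction n with
      | zero => rw [pow_zero]; exact le_one' m
      | succ n ih =>
        rw [pow_succ]
        refine hmm.trans ?_
        rw [sq]
        exact mul_le_mul_left ih m
    rw [hinf x fun n => (hmax x hx1).trans (hmn n)]
    exact hbot
  obtain ⟨e, he, hem, he2⟩ := exists_isPrincipal_of_not_le hP hmm
  have hme := (hcomp e).resolve_right he2
  have key : ∀ k : ℕ, HasOAFactorization x ∨ ∃ y, y ≤ m ^ 2 ∧ x = y * e ^ k := by
    intro k
    induction k with
    | zero => exact Or.inr ⟨x, hx2, by simp⟩
    | succ k ih =>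
      rcases ih with h | ⟨y, hy, hxy⟩
      · exact Or.inl h
      have h3 := he.residual_mul_eq (hy.trans hme)
      have h4 : residual y e ≠ 1 := fun h4 => he2 (by
        rw [h4, one_mul] at h3; exact h3.le.trans hy)
      have h5 : x = residual y e * e ^ (k + 1) := by rw [pow_succ', ← mul_assoc, h3, hxy]
      by_cases h6 : residual y e ≤ m ^ 2
      · exact Or.inr ⟨_, h6, h5⟩
      · left
        rw [h5]
        exact (hoa _ h4 h6).mul ((hoa e (fun h => hm1 (eq_one_of_le (h ▸ hem))) he2).pow _)
  by_cases hx : HasOAFactorization x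
  · exact hx
  rw [hinf x fun n => ?_]
  · exact hbot
  · obtain ⟨y, -, hxy⟩ := (key n).resolve_left hx
    rw [hxy]
    exact (mul_le_right _ _).trans (pow_le_pow_left' hem n)

theorem HasOAFactorization.isOAElement {z : L} (hz : HasOAFactorization z)
    (hmax : ∀ y : L, y ≠ 1 → y ≤ m) (hz1 : z ≠ 1) (hz2 : ¬ z ≤ m ^ 2) : IsOAElement z := by
  obtain ⟨s, hs, rfl⟩ := hz
  induction s using Multiset.induction_on with
  | empty => exact absurd Multiset.prod_zero hz1
  | cons a s _ =>
    induction s using Multiset.induction_on with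
    | empty => simpa using hs a
    | cons b s _ =>
      refine absurd ?_ hz2
      rw [Multiset.prod_cons, Multiset.prod_cons, ← mul_assoc, sq]
      exact (mul_le_left _ _).trans (mul_le_mul' (hmax a (hs a (by simp)).1.ne)
        (hmax b (hs b (by simp)).1.ne))

/-- A join `x ⊔ f` with `f ≤ m` is not below `m ^ 2`, so it is a single OA-element: prime or above
`m ^ 2`. If `x` itself were only prime, take `a ≤ m` not below `x`. Then `a * a` is not below `x`
either, and Nakayama excludes that `x ⊔ (a * a) * (a * a)` is prime; so it contains `m ^ 2`, hence
`a * a`, and Nakayama gives `a * a ≤ x`. -/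
theorem sq_le_of_isPrincipal (hC : IsCLattice L) (hP : IsPrincipallyGenerated L)
    (hF : ∀ a b : L, IsPrincipal a → IsPrincipal b → HasOAFactorization (a ⊔ b))
    (hm : IsCoatom m) (hmax : ∀ y : L, y ≠ 1 → y ≤ m) {x : L} (hx : IsPrincipal x)
    (hxm : x ≤ m) (hx2 : ¬ x ≤ m ^ 2) : m ^ 2 ≤ x := by
  have hmp := isPrimeElement_of_isCoatom hm
  have hcases : ∀ f, IsPrincipal f → f ≤ m → IsPrimeElement (x ⊔ f) ∨ m ^ 2 ≤ x ⊔ f := by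
    intro f hf hfm
    have hle : x ⊔ f ≤ m := sup_le hxm hfm
    have hoa := (hF x f hx hf).isOAElement hmax
      (fun h => hmp.not_one_le (h ▸ hle)) fun h => hx2 (le_sup_left.trans h)
    rcases hoa.isPrimeElement_or hC.isCompactElement_one with h | ⟨m', hm', hmax', h⟩
    · exact Or.inl h
    · rw [le_antisymm (hmax m' (isCoatom_lt_one hm').ne) (hmax' m (isCoatom_lt_one hm).ne)] at h
      exact Or.inr h
  have hnak : ∀ a, IsPrincipal a → a ≤ m → a ≤ x ⊔ a * a → a ≤ x := by
    intro a ha ham h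
    refine (LocLE.of_mul_le_sup ha hmp.not_one_le ?_).le_of_isMax hmax
    rw [one_mul, sup_comm]
    exact h.trans (sup_le_sup le_rfl (mul_le_mul_right ham a))
  have key : ∀ a, IsPrincipal a → a ≤ m → ¬ a ≤ x → m ^ 2 ≤ x ⊔ a * a := by
    intro a ha ham hax
    refine (hcases (a * a) (ha.mul ha) ((mul_le_left _ _).trans ham)).resolve_left fun h => ?_
    exact hax (hnak a ha ham ((h.2 a a le_sup_right).elim id id))
  by_contra hmx
  have hxp : IsPrimeElement x := by
    have := hcases x hx hxm
    rw [sup_idem] at this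
    exact this.resolve_right hmx
  obtain ⟨a, ha, ham, hax⟩ := exists_isPrincipal_of_not_le hP
    (fun h : m ≤ x => hmx (le_trans (by rw [sq]; exact mul_le_left _ _) h))
  have haa : ¬ a * a ≤ x := hxp.mul_not_le hax hax
  have haam : a * a ≤ m := (mul_le_left _ _).trans ham
  refine haa (hnak _ (ha.mul ha) haam (le_trans ?_ (key _ (ha.mul ha) haam haa)))
  rw [sq]
  exact mul_le_mul' ham ham

theorem isComparable_sq (hC : IsCLattice L) (hP : IsPrincipallyGenerated L)
    (hF : ∀ a b : L, IsPrincipal a → IsPrincipal b → HasOAFactorization (a ⊔ b))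
    (hm : IsCoatom m) (hmax : ∀ y : L, y ≠ 1 → y ≤ m) : IsComparable (m ^ 2) := by
  intro b
  by_cases hb : b ≤ m ^ 2
  · exact Or.inr hb
  left
  obtain ⟨e, he, heb, he2⟩ := exists_isPrincipal_of_not_le hP hb
  rcases eq_or_ne e 1 with rfl | he1
  · exact (le_one' _).trans heb
  · exact (sq_le_of_isPrincipal hC hP hF hm hmax he (hmax e he1) he2).trans heb

theorem isNilpotentElement_or_isLatticeDomain (hC : IsCLattice L)
    (hP : IsPrincipallyGenerated L)
    (hF : ∀ a b : L, IsPrincipal a → IsPrincipal b → HasOAFactorization (a ⊔ b))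
    (hm : IsCoatom m) (hmax : ∀ y : L, y ≠ 1 → y ≤ m) (hmm : ¬ m ≤ m ^ 2) :
    IsNilpotentElement m ∨ IsLatticeDomain L ∧ ⨅ n : ℕ, m ^ n = ⊥ := by
  have hmp := isPrimeElement_of_isCoatom hm
  have hcomp := isComparable_sq hC hP hF hm hmax
  obtain ⟨e, he, hem, he2⟩ := exists_isPrincipal_of_not_le hP hmm
  have hme := (hcomp e).resolve_right he2
  have hpow := pow_succ_eq_mul_pow hmax he hem he2 hme
  refine or_iff_not_imp_left.2 fun hnil => ?_
  have hek : ∀ k : ℕ, ¬ e ^ k ≤ m ^ (k + 1) := by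
    intro k h
    have h0 : e ^ k ≤ ⊥ := (LocLE.bot_of_mul_le (t := m) (he.pow k) hmp.not_one_le
      (by rw [one_mul, mul_comm, ← hpow]; exact h)).le_of_isMax hmax
    exact hnil ⟨k + 1, by rw [hpow, le_bot_iff.1 h0, Quantale.mul_bot]⟩
  set I : L := ⨅ n : ℕ, m ^ n with hI
  have hIle : ∀ n : ℕ, I ≤ m ^ n := fun n => iInf_le _ n
  -- Valuation argument: with `n = j + 2` the least exponent such that `¬ a ≤ m ^ n`, `a` is `e ^ j`
  -- times a cofactor not below `m ^ 2`, hence above it, so `e ^ (j + 2) ≤ a`.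
  have hbig : ∀ a : L, ¬ a ≤ I → ∃ i : ℕ, e ^ i ≤ a := by
    intro a ha
    have hex : ∃ n : ℕ, ¬ a ≤ m ^ n := by
      by_contra! h
      exact ha (le_iInf h)
    classical
    obtain ⟨n, hn⟩ : ∃ n, Nat.find hex = n := ⟨_, rfl⟩
    have hspec : ¬ a ≤ m ^ n := hn ▸ Nat.find_spec hex
    have hmin : ∀ k < n, a ≤ m ^ k := fun k hk => not_not.1 (Nat.find_min hex (hn.symm ▸ hk))
    match n, hspec, hmin with
    | 0, hspec, _ => exact absurd (le_one' a) (by simpa using hspec)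
    | 1, hspec, _ =>
      rw [pow_one] at hspec
      have : a = 1 := by_contra fun h => hspec (hmax a h)
      exact ⟨0, by rw [this, pow_zero]⟩
    | j + 2, hspec, hmin =>
      have haj : a ≤ m * e ^ j := hpow j ▸ hmin (j + 1) (by omega)
      have h1 := (he.pow j).residual_mul_eq (haj.trans (mul_le_right _ _))
      have h2 : m ^ 2 ≤ residual a (e ^ j) := by
        refine (hcomp _).resolve_right fun h => hspec ?_
        rw [← h1, pow_succ, hpow, mul_right_comm, ← sq]
        exact mul_le_mul_left h _
      refine ⟨j + 2, ?_⟩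
      rw [← h1, pow_add, mul_comm]
      exact mul_le_mul_left ((pow_le_pow_left' hem 2).trans h2) _
  have hIp : IsPrimeElement I := by
    refine ⟨lt_of_le_of_lt ((hIle 1).trans (pow_one m).le) hmp.1, fun a b hab => ?_⟩
    by_contra! h
    obtain ⟨i, hi⟩ := hbig a h.1
    obtain ⟨j, hj⟩ := hbig b h.2
    refine hek (i + j) (le_trans ?_ (hab.trans (hIle _)))
    rw [pow_add]
    exact mul_le_mul' hi hj
  have hI0 : I = ⊥ := by
    refine le_bot_iff.1 (isPrincipal_le_of_forall hP fun f hf hfI => ?_)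
    have hFf := hF f f hf hf
    rw [sup_idem] at hFf
    obtain ⟨s, hs, hfs⟩ := hFf
    obtain ⟨y, hy, hyI⟩ := hIp.multiset_prod_le (hfs ▸ hfI)
    -- A non-prime factor would satisfy `m ^ 2 ≤ y ≤ I ≤ m ^ 3`, against `hek 2`.
    have hyp : IsPrimeElement y := by
      rcases (hs y hy).isPrimeElement_or hC.isCompactElement_one with h | ⟨m', hm', hmax', h⟩
      · exact h
      · rw [le_antisymm (hmax m' (isCoatom_lt_one hm').ne) (hmax' m (isCoatom_lt_one hm).ne)] at h
        exact absurd ((pow_le_pow_left' hem 2).trans (h.trans (hyI.trans (hIle 3)))) (hek 2)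
    have hey : ¬ e ≤ y := fun h => he2 (h.trans (hyI.trans (hIle 2)))
    have h1 := he.residual_mul_eq (hyI.trans ((hIle 2).trans hme))
    have h2 : residual y e ≤ y := (hyp.2 _ _ h1.le).resolve_right hey
    obtain ⟨t, rfl⟩ := Multiset.exists_cons_of_mem hy
    rw [Multiset.prod_cons] at hfs
    refine (LocLE.bot_of_mul_le (t := m) hf hmp.not_one_le ?_).le_of_isMax hmax
    rw [one_mul]
    calc f = residual y e * e * t.prod := by rw [h1, hfs]
      _ ≤ y * e * t.prod := mul_le_mul_left (mul_le_mul_left h2 e) _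
      _ = f * e := by rw [hfs, mul_right_comm]
      _ ≤ f * m := mul_le_mul_right hem f
  exact ⟨show IsPrimeElement (⊥ : L) from hI0 ▸ hIp, hI0⟩

end Local

/-! ### The Jacobson radical of a quasi-local lattice, and the equivalences -/

theorem isQuasiLocal_of_isCoatom (h1 : IsCompactElement (1 : L)) {m : L} (hm : IsCoatom m)
    (hmax : ∀ y : L, y ≠ 1 → y ≤ m) : IsQuasiLocal L :=
  ⟨h1, m, hm, fun y hy => ((hy.le_iff.1 (hmax y (isCoatom_lt_one hy).ne)).resolve_left hm.1).symm⟩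

theorem IsQuasiLocal.jacobson_eq (h : IsQuasiLocal L) {m : L} (hm : IsCoatom m) :
    jacobson L = m := by
  obtain ⟨-, n, hn, huniq⟩ := h
  have : {m : L | IsCoatom m} = {m} := by
    ext y
    simp only [Set.mem_ofPred_eq, Set.mem_singleton_iff]
    exact ⟨fun hy => (huniq y hy).trans (huniq m hm).symm, fun hy => hy ▸ hm⟩
  rw [jacobson, this, sInf_singleton]

theorem IsQuasiLocal.isCoatom_jacobson (h : IsQuasiLocal L) : IsCoatom (jacobson L) := by
  obtain ⟨n, hn, -⟩ := h.2
  rwa [h.jacobson_eq hn]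

theorem IsQuasiLocal.le_jacobson (h : IsQuasiLocal L) {y : L} (hy : y ≠ 1) :
    y ≤ jacobson L := by
  obtain ⟨n, hn, hyn⟩ := exists_isCoatom_ge h.1 hy
  rwa [h.jacobson_eq hn]

theorem IsZPILattice.isOAFL (h : IsZPILattice L) : IsOAFL L := fun x => by
  obtain ⟨s, hs, hx⟩ := h x
  exact ⟨s, fun y hy => (hs y hy).isOAElement, hx⟩

end OA

end MultLattice

theorem theorem4p13 {L : Type*} [CommMonoid L] [CompleteLattice L]
    [MultLattice.IsMultiplicativeLattice L]
    (hC : MultLattice.IsCLattice L) (hP : MultLattice.IsPrincipallyGenerated L)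
    (m : L) (hm : m = MultLattice.jacobson L) :
    List.TFAE [
      MultLattice.IsOAFL L,
      MultLattice.IsCOAFL L,
      ∀ a b : L, MultLattice.IsPrincipal a → MultLattice.IsPrincipal b →
        MultLattice.HasOAFactorization (a ⊔ b),
      MultLattice.IsZPILattice L ∨
        (MultLattice.IsQuasiLocal L ∧ MultLattice.IsComparable (m ^ 2) ∧
          MultLattice.IsNilpotentElement m) ∨
        (MultLattice.IsQuasiLocal L ∧ MultLattice.IsLatticeDomain L ∧
          MultLattice.IsComparable (m ^ 2) ∧ (⨅ n : ℕ, m ^ n) = ⊥)] := by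
  open MultLattice in
  have h1 := hC.isCompactElement_one
  tfae_have 1 → 2 := fun h x _ => h x
  tfae_have 2 → 3 := fun h a b ha hb =>
    h _ (isCompactElement_sup (ha.isCompactElement hC) (hb.isCompactElement hC))
  tfae_have 3 → 4 := by
    intro hF
    by_cases hall : ∀ x : L, IsOAElement x → IsPrimeElement x
    · left
      refine isZPILattice_of_supHasPrimeFactorization hC hP fun a b ha hb => ?_
      obtain ⟨s, hs, h⟩ := hF a b ha hb
      exact ⟨s, fun y hy => hall y (hs y hy), h⟩
    · right
      push Not at hall
      obtain ⟨x, hx, hxp⟩ := hall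
      obtain ⟨n, hn, hmax, hnx⟩ := (hx.isPrimeElement_or h1).resolve_left hxp
      have hq := isQuasiLocal_of_isCoatom h1 hn hmax
      rw [hm, hq.jacobson_eq hn]
      -- An idempotent `n` would equal the non-prime `x`, since `n ^ 2 ≤ x ≤ n`.
      have hnn : ¬ n ≤ n ^ 2 := fun h => hxp
        (le_antisymm (hmax x hx.1.ne) (h.trans hnx) ▸ isPrimeElement_of_isCoatom hn)
      have hcomp := isComparable_sq hC hP hF hn hmax
      rcases isNilpotentElement_or_isLatticeDomain hC hP hF hn hmax hnn with h | h
      · exact Or.inl ⟨hq, hcomp, h⟩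
      · exact Or.inr ⟨hq, h.1, hcomp, h.2⟩
  tfae_have 4 → 1 := by
    rintro (h | ⟨hq, hcomp, n, hn⟩ | ⟨hq, hd, hcomp, hinf⟩)
    · exact h.isOAFL
    · subst hm
      have hm1 := (isCoatom_lt_one hq.isCoatom_jacobson).ne
      refine isOAFL_of_isComparable_sq hP (fun y => hq.le_jacobson) hm1 hcomp ?_ fun x hx =>
        le_bot_iff.1 (hn ▸ hx n)
      rw [← hn]
      exact (isPrimeElement_of_isCoatom hq.isCoatom_jacobson).isOAElement.hasOAFactorization.pow n
    · subst hm
      have hm1 := (isCoatom_lt_one hq.isCoatom_jacobson).ne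
      refine isOAFL_of_isComparable_sq hP (fun y => hq.le_jacobson) hm1 hcomp
        (IsPrimeElement.isOAElement hd).hasOAFactorization fun x hx => ?_
      exact le_bot_iff.1 (hinf ▸ le_iInf hx)
  tfae_finish
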